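/- Let $1<p\le 2$ and let $X$ be a separable real Banach space that is $p$-uniformly smooth, i.e. there is $s>0$ with $$\rho_X(\tau):=\sup\Big\{\tfrac{\|x+\tau y\|+\|x-\tau y\|}{2}-1:\ x,y\in X,\ \|x\|=\|y\|=1\Big\}\le s\,\tau^p\qquad\text{for all }\tau>0.$$ Then there is a constant $K>0$, depending only on $X$ (and $p$), such that the following holds. Let $f=(f_j)_{j\ge 0}$ be an $X$-valued martingale on a probability space $(\Omega,\mathscr F,\mathbb P)$ with respect to some filtration, with differences $d_j=f_j-f_{j-1}$ ($j\ge 1$), and suppose that $f$ is conditionally symmetric, i.e. for every $j\ge 1$ and every bounded continuous $\varphi:X^j\to\mathbb R$, $$\mathbb E\,\varphi(d_1,\dots,d_{j-1},d_j)=\mathbb E\,\varphi(d_1,\dots,d_{j-1},-d_j).$$ Put $f^*=\sup_{j\ge 1}\|f_j-f_0\|$ and $S_p(f)=\big(\sum_{j=1}^\infty\|d_j\|^p\big)^{1/p}$ (both with values in $[0,\infty]$). If $0<b<\infty$ and $b\ge\|S_p^p(f)\|_\infty$ (the essential supremum of $S_p(f)^p$), then for all $r\ge 0$ $$\mathbb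 P\{f^*\ge r\}\le 2\exp\Big(-\frac{r^p}{2Kb}\Big).$$ -/

import Mathlib

open MeasureTheory ProbabilityTheory
open scoped ENNReal NNReal BoundedContinuousFunction

namespace BanachMartingale

/-- The modulus of uniform smoothness
`ρ_X(τ) = sup {(‖x + τ y‖ + ‖x - τ y‖) / 2 - 1 : ‖x‖ = ‖y‖ = 1}`.
For `τ > 0` the set is bounded above by `τ`; it is empty only if `X = 0`, where the value is `0`. -/
noncomputable def smoothnessModulus (X : Type*) [NormedAddCommGroup X] [NormedSpace ℝ X]
    (τ : ℝ) : ℝ :=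
  sSup {t : ℝ | ∃ x y : X, ‖x‖ = 1 ∧ ‖y‖ = 1 ∧ t = (‖x + τ • y‖ + ‖x - τ • y‖) / 2 - 1}

/-- `X` is `p`-uniformly smooth: there is `s > 0` with `ρ_X(τ) ≤ s τ ^ p` for all `τ > 0`. -/
def IsUniformlySmooth (X : Type*) [NormedAddCommGroup X] [NormedSpace ℝ X] (p : ℝ) : Prop :=
  ∃ s : ℝ, 0 < s ∧ ∀ τ : ℝ, 0 < τ → smoothnessModulus X τ ≤ s * τ ^ p

variable {Ω X : Type*} [NormedAddCommGroup X]

/-- The sequence of differences of a process; `difference f j` is the `(j + 1)`-st difference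
`d_{j+1} = f_{j+1} - f_j`, so that `d_1, d_2, …` are indexed by `0, 1, …`. -/
def difference (f : ℕ → Ω → X) (j : ℕ) (ω : Ω) : X :=
  f (j + 1) ω - f j ω

/-- The maximal function `f* = sup_{j ≥ 1} ‖f_j - f_0‖`, with values in `[0, ∞]`. -/
noncomputable def maximalFunction (f : ℕ → Ω → X) (ω : Ω) : ℝ≥0∞ :=
  ⨆ j : ℕ, ‖f (j + 1) ω - f 0 ω‖ₑ

/-- `S_p(f) = (∑_{j ≥ 1} ‖d_j‖ ^ p) ^ (1 / p)`, with values in `[0, ∞]`. -/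
noncomputable def pFunction (p : ℝ) (f : ℕ → Ω → X) (ω : Ω) : ℝ≥0∞ :=
  (∑' j : ℕ, ‖difference f j ω‖ₑ ^ p) ^ (1 / p)

/-- Conditional symmetry: for every `j ≥ 1` and every bounded continuous `φ : X ^ j → ℝ`,
`E φ(d_1, …, d_{j-1}, d_j) = E φ(d_1, …, d_{j-1}, -d_j)`.
Below, `j` is written as `k + 1`. -/
def IsConditionallySymmetric [MeasurableSpace Ω] (f : ℕ → Ω → X) (μ : Measure Ω) : Prop :=
  ∀ (k : ℕ) (φ : (Fin (k + 1) → X) →ᵇ ℝ),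
    ∫ ω, φ (Fin.snoc (α := fun _ => X) (fun i : Fin k => difference f i ω)
        (difference f k ω)) ∂μ =
      ∫ ω, φ (Fin.snoc (α := fun _ => X) (fun i : Fin k => difference f i ω)
        (-difference f k ω)) ∂μ

end BanachMartingale

/-! Smoothness controls the mean of `‖x + y‖` and `‖x - y‖`, which yields `cosh ‖x+y‖ + cosh ‖x-y‖ ≤
2 cosh ‖x‖ exp (c ‖y‖^p)` with `c = 2s + 3` (`cosh_norm_add_add_cosh_norm_sub_le`). Conditional
symmetry allows averaging over the sign of the last difference, so `cosh (l ‖·‖)` of the partial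
sums, divided by `exp (c l^p ∑ ‖d_j‖^p)`, has nonincreasing expectation
(`lintegral_compensatedCosh_le_one`). Stopping at a level turns the maximal function into a
fixed-time event, to which Markov's inequality applies. Finally `l` is chosen when `b ≤ r^p`;
otherwise the bound is trivial. -/

namespace BanachMartingale

/-! ### Uniform smoothness and the hyperbolic cosine of the norm -/

section Smoothness

variable {X : Type*} [NormedAddCommGroup X] [NormedSpace ℝ X]

lemma le_smoothnessModulus {x y : X} (hx : ‖x‖ = 1) (hy : ‖y‖ = 1) {τ : ℝ} (hτ : 0 < τ) :
    (‖x + τ • y‖ + ‖x - τ • y‖) / 2 - 1 ≤ smoothnessModulus X τ := by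
  refine le_csSup ⟨τ, ?_⟩ ⟨x, y, hx, hy, rfl⟩
  rintro t ⟨x, y, hx, hy, rfl⟩
  have h1 := norm_add_le x (τ • y)
  have h2 := norm_sub_le x (τ • y)
  rw [norm_smul, hx, hy, Real.norm_of_nonneg hτ.le] at h1 h2
  linarith

/-- The mean of `‖x + y‖` and `‖x - y‖`, estimated by the modulus of smoothness. -/
lemma norm_add_add_norm_sub_le {p s : ℝ}
    (hs : ∀ τ : ℝ, 0 < τ → smoothnessModulus X τ ≤ s * τ ^ p) {x y : X} (hx : x ≠ 0)
    (hy : y ≠ 0) :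
    (‖x + y‖ + ‖x - y‖) / 2 - ‖x‖ ≤ s * ‖x‖ ^ (1 - p) * ‖y‖ ^ p := by
  have hx' : 0 < ‖x‖ := norm_pos_iff.2 hx
  have hy' : 0 < ‖y‖ := norm_pos_iff.2 hy
  have hτ : 0 < ‖y‖ / ‖x‖ := div_pos hy' hx'
  have hux : ‖‖x‖⁻¹ • x‖ = 1 := by
    rw [norm_smul, norm_inv, norm_norm, inv_mul_cancel₀ hx'.ne']
  have huy : ‖‖y‖⁻¹ • y‖ = 1 := by
    rw [norm_smul, norm_inv, norm_norm, inv_mul_cancel₀ hy'.ne']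
  have h := (le_smoothnessModulus hux huy hτ).trans (hs _ hτ)
  have hy2 : (‖y‖ / ‖x‖) • (‖y‖⁻¹ • y) = ‖x‖⁻¹ • y := by
    rw [smul_smul]
    congr 1
    field_simp
  rw [hy2, ← smul_add, ← smul_sub, norm_smul, norm_smul, norm_inv, norm_norm,
    Real.div_rpow hy'.le hx'.le] at h
  have h2 := mul_le_mul_of_nonneg_left h hx'.le
  rw [Real.rpow_sub hx', Real.rpow_one]
  calc _ = ‖x‖ * ((‖x‖⁻¹ * ‖x + y‖ + ‖x‖⁻¹ * ‖x - y‖) / 2 - 1) := by field_simp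
    _ ≤ _ := h2
    _ = _ := by ring

lemma sinh_le_mul_cosh {t : ℝ} (ht : 0 ≤ t) : Real.sinh t ≤ t * Real.cosh t := by
  have hmono : MonotoneOn (fun t : ℝ => t * Real.cosh t - Real.sinh t) (Set.Ici 0) := by
    refine monotoneOn_of_deriv_nonneg (convex_Ici 0) (by fun_prop) (by fun_prop) fun x hx => ?_
    rw [interior_Ici] at hx
    have hd : HasDerivAt (fun t : ℝ => t * Real.cosh t - Real.sinh t)
        (1 * Real.cosh x + x * Real.sinh x - Real.cosh x) x :=
      ((hasDerivAt_id x).mul (Real.hasDerivAt_cosh x)).sub (Real.hasDerivAt_sinh x)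
    rw [hd.deriv]
    have := mul_nonneg (le_of_lt hx) (Real.sinh_nonneg_iff.2 (le_of_lt hx))
    linarith
  have := hmono Set.self_mem_Ici ht ht
  simp only [zero_mul, Real.sinh_zero, sub_zero] at this
  linarith

lemma cosh_add_le_cosh_mul_exp (t : ℝ) {δ : ℝ} (hδ : 0 ≤ δ) :
    Real.cosh (t + δ) ≤ Real.cosh t * Real.exp δ := by
  rw [Real.cosh_add, ← Real.cosh_add_sinh, mul_add]
  have := mul_le_mul_of_nonneg_right (Real.sinh_lt_cosh t).le (Real.sinh_nonneg_iff.2 hδ)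
  linarith

/-- For small `t` the factor `t` in `t * δ` matters: near the origin `δ` is only of first order in
`‖y‖`. -/
lemma cosh_add_le_cosh_mul_exp_mul {t δ : ℝ} (ht : 0 ≤ t) (hδ : 0 ≤ δ) :
    Real.cosh (t + δ) ≤ Real.cosh t * Real.exp (t * δ + δ ^ 2 / 2) := by
  have h1 := mul_le_mul (sinh_le_mul_cosh ht) (sinh_le_mul_cosh hδ) (Real.sinh_nonneg_iff.2 hδ)
    (mul_nonneg ht (Real.cosh_pos t).le)
  calc Real.cosh (t + δ) = Real.cosh t * Real.cosh δ + Real.sinh t * Real.sinh δ :=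
      Real.cosh_add t δ
    _ ≤ Real.cosh t * ((t * δ + 1) * Real.cosh δ) := by linarith
    _ ≤ Real.cosh t * (Real.exp (t * δ) * Real.exp (δ ^ 2 / 2)) := by
      gcongr
      · exact Real.add_one_le_exp _
      · exact Real.cosh_le_exp_half_sq δ
    _ = _ := by rw [Real.exp_add]

/-- In a `p`-uniformly smooth space the function `cosh ‖·‖` grows slowly under symmetric
perturbations. -/
lemma cosh_norm_add_add_cosh_norm_sub_le {p s : ℝ} (hp1 : 1 < p) (hp2 : p ≤ 2) (hs0 : 0 < s)
    (hs : ∀ τ : ℝ, 0 < τ → smoothnessModulus X τ ≤ s * τ ^ p) (x y : X) :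
    Real.cosh ‖x + y‖ + Real.cosh ‖x - y‖ ≤
      2 * (Real.cosh ‖x‖ * Real.exp ((2 * s + 3) * ‖y‖ ^ p)) := by
  have hadd := norm_add_le x y
  have hsub := norm_sub_le x y
  have hyp : 0 ≤ ‖y‖ ^ p := Real.rpow_nonneg (norm_nonneg y) p
  rcases le_total 1 ‖y‖ with hy1 | hy1
  -- For `‖y‖ ≥ 1` the triangle inequality suffices, since `‖y‖ ≤ ‖y‖ ^ p`.
  · have hle : ‖y‖ ≤ (2 * s + 3) * ‖y‖ ^ p := by
      have := Real.rpow_le_rpow_of_exponent_le hy1 hp1.le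
      rw [Real.rpow_one] at this
      nlinarith
    have key : ∀ a, 0 ≤ a → a ≤ ‖x‖ + ‖y‖ →
        Real.cosh a ≤ Real.cosh ‖x‖ * Real.exp ((2 * s + 3) * ‖y‖ ^ p) := fun a ha h =>
      calc Real.cosh a ≤ Real.cosh (‖x‖ + ‖y‖) := by
            rw [Real.cosh_le_cosh, abs_of_nonneg ha, abs_of_nonneg (by positivity)]
            exact h
        _ ≤ Real.cosh ‖x‖ * Real.exp ‖y‖ := cosh_add_le_cosh_mul_exp _ (norm_nonneg y)
        _ ≤ _ := by
            gcongr
    linarith [key _ (norm_nonneg _) hadd, key _ (norm_nonneg _) hsub]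
  rcases eq_or_ne y 0 with rfl | hy
  · simp [Real.zero_rpow (by linarith : p ≠ 0), two_mul]
  have hy' : 0 < ‖y‖ := norm_pos_iff.2 hy
  have hsq : ‖y‖ ^ 2 ≤ ‖y‖ ^ p := by
    rw [← Real.rpow_two]
    exact Real.rpow_le_rpow_of_exponent_ge hy' hy1 hp2
  -- Sum-to-product: the sum of the two cosh is `2 cosh (‖x‖ + δ)` times the cosh of the
  -- half-difference; the latter is at most `‖y‖` in absolute value.
  set δ := (‖x + y‖ + ‖x - y‖) / 2 - ‖x‖ with hδ
  have hδ0 : 0 ≤ δ := by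
    have h := norm_add_le (x + y) (x - y)
    rw [show x + y + (x - y) = (2 : ℝ) • x by rw [two_smul]; abel, norm_smul,
      Real.norm_of_nonneg zero_le_two] at h
    linarith
  have hδy : δ ≤ ‖y‖ := by linarith
  have hsmooth : ∀ {z : ℝ}, x ≠ 0 → s * ‖x‖ ^ (1 - p) ≤ z → δ ≤ z * ‖y‖ ^ p := fun hx h =>
    (norm_add_add_norm_sub_le hs hx hy).trans (by gcongr)
  have hmid : Real.cosh (‖x‖ + δ) ≤ Real.cosh ‖x‖ * Real.exp ((2 * s + 2) * ‖y‖ ^ p) := by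
    rcases le_total 1 ‖x‖ with hx1 | hx1
    · refine (cosh_add_le_cosh_mul_exp _ hδ0).trans ?_
      have h1 : ‖x‖ ^ (1 - p) ≤ 1 := Real.rpow_le_one_of_one_le_of_nonpos hx1 (by linarith)
      have h2 : δ ≤ s * ‖y‖ ^ p :=
        hsmooth (norm_pos_iff.1 (by linarith)) (by nlinarith)
      gcongr
      nlinarith
    refine (cosh_add_le_cosh_mul_exp_mul (norm_nonneg x) hδ0).trans ?_
    have hδsq : δ ^ 2 ≤ ‖y‖ ^ 2 := by gcongr
    suffices h : ‖x‖ * δ ≤ (2 * s + 1) * ‖y‖ ^ p by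
      gcongr
      nlinarith
    -- If `‖y‖ ≤ ‖x‖ ≤ 1`, smoothness leaves a factor `‖x‖ ^ (2 - p) ≤ 1`; otherwise `δ ≤ ‖y‖`
    -- already gives a quadratic bound.
    rcases le_total ‖y‖ ‖x‖ with hxy | hxy
    · have hx' : 0 < ‖x‖ := hy'.trans_le hxy
      have h1 : ‖x‖ * ‖x‖ ^ (1 - p) ≤ 1 := by
        nth_rw 1 [← Real.rpow_one ‖x‖]
        rw [← Real.rpow_add hx']
        exact Real.rpow_le_one hx'.le hx1 (by linarith)
      have h2 := mul_le_mul_of_nonneg_left (hsmooth (norm_pos_iff.1 hx') le_rfl) hx'.le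
      have h3 : s * (‖x‖ * ‖x‖ ^ (1 - p)) * ‖y‖ ^ p ≤ s * 1 * ‖y‖ ^ p := by gcongr
      nlinarith
    · have : ‖x‖ * δ ≤ ‖y‖ * ‖y‖ := by gcongr
      nlinarith
  have hdiff : Real.cosh ((‖x + y‖ - ‖x - y‖) / 2) ≤ Real.exp (‖y‖ ^ p) := by
    refine (Real.cosh_le_exp_half_sq _).trans (Real.exp_le_exp.2 ?_)
    have h1 : |‖x + y‖ - ‖x - y‖| ≤ 2 * ‖y‖ := by
      refine (abs_norm_sub_norm_le _ _).trans ?_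
      rw [show x + y - (x - y) = (2 : ℝ) • y by rw [two_smul]; abel, norm_smul,
        Real.norm_of_nonneg zero_le_two]
    have h2 := abs_le.1 h1
    nlinarith [h2.1, h2.2]
  have hprod : Real.cosh ‖x + y‖ + Real.cosh ‖x - y‖ =
      2 * (Real.cosh (‖x‖ + δ) * Real.cosh ((‖x + y‖ - ‖x - y‖) / 2)) := by
    have h1 := Real.cosh_add (‖x‖ + δ) ((‖x + y‖ - ‖x - y‖) / 2)
    have h2 := Real.cosh_sub (‖x‖ + δ) ((‖x + y‖ - ‖x - y‖) / 2)
    rw [show ‖x‖ + δ + (‖x + y‖ - ‖x - y‖) / 2 = ‖x + y‖ by rw [hδ]; ring] at h1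
    rw [show ‖x‖ + δ - (‖x + y‖ - ‖x - y‖) / 2 = ‖x - y‖ by rw [hδ]; ring] at h2
    linarith
  rw [hprod]
  calc 2 * (Real.cosh (‖x‖ + δ) * Real.cosh ((‖x + y‖ - ‖x - y‖) / 2))
      ≤ 2 * ((Real.cosh ‖x‖ * Real.exp ((2 * s + 2) * ‖y‖ ^ p)) * Real.exp (‖y‖ ^ p)) := by
        gcongr
    _ = _ := by
        rw [mul_assoc, ← Real.exp_add]
        ring_nf

end Smoothness

end BanachMartingale

namespace BanachMartingale

/-! ### Stopped sums and the compensated cosh, pathwise -/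

section StoppedSum

variable {X : Type*} [NormedAddCommGroup X]

/-- The partial sums of `d`, stopped as soon as their norm reaches `r`. -/
noncomputable def stoppedSum (r : ℝ) (d : ℕ → X) : ℕ → X
  | 0 => 0
  | n + 1 => if ‖stoppedSum r d n‖ < r then stoppedSum r d n + d n else stoppedSum r d n

lemma stoppedSum_congr {r : ℝ} {d e : ℕ → X} {n : ℕ} (h : ∀ j < n, d j = e j) :
    stoppedSum r d n = stoppedSum r e n := by
  induction n with
  | zero => rfl
  | succ n ih =>
    simp only [stoppedSum, ih fun j hj => h j (hj.trans n.lt_succ_self), h n n.lt_succ_self]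

lemma stoppedSum_eq_of_le {r : ℝ} {d : ℕ → X} {n m : ℕ} (h : r ≤ ‖stoppedSum r d n‖)
    (hnm : n ≤ m) : stoppedSum r d m = stoppedSum r d n := by
  induction m, hnm using Nat.le_induction with
  | base => rfl
  | succ m _ ih => rw [stoppedSum, ih, if_neg h.not_gt]

lemma stoppedSum_eq_sum_or (r : ℝ) (d : ℕ → X) (n : ℕ) :
    stoppedSum r d n = ∑ j ∈ Finset.range n, d j ∨ r ≤ ‖stoppedSum r d n‖ := by
  induction n with
  | zero => exact .inl rfl
  | succ n ih =>
    by_cases h : ‖stoppedSum r d n‖ < r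
    · left
      rw [stoppedSum, if_pos h, Finset.sum_range_succ, ih.resolve_right h.not_ge]
    · right
      rw [stoppedSum, if_neg h]
      exact not_lt.1 h

lemma le_norm_stoppedSum {r : ℝ} {d : ℕ → X} {n : ℕ}
    (h : r ≤ ‖∑ j ∈ Finset.range n, d j‖) : r ≤ ‖stoppedSum r d n‖ := by
  rcases stoppedSum_eq_sum_or r d n with h' | h'
  · rwa [h']
  · exact h'

lemma measurable_stoppedSum [MeasurableSpace X] [BorelSpace X] [SecondCountableTopology X]
    (r : ℝ) (n : ℕ) : Measurable fun d : ℕ → X => stoppedSum r d n := by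
  induction n with
  | zero => exact measurable_const
  | succ n ih =>
    exact Measurable.ite (measurableSet_lt ih.norm measurable_const)
      (ih.add (measurable_pi_apply n)) ih

/-- `cosh (l ‖·‖)` of the stopped sums, compensated by the sum of the `p`-th powers of the
norms. -/
noncomputable def compensatedCosh (p c l r : ℝ) (n : ℕ) (d : ℕ → X) : ℝ :=
  Real.cosh (l * ‖stoppedSum r d n‖) *
    Real.exp (-(c * l ^ p * ∑ j ∈ Finset.range n, ‖d j‖ ^ p))

lemma compensatedCosh_nonneg (p c l r : ℝ) (n : ℕ) (d : ℕ → X) :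
    0 ≤ compensatedCosh p c l r n d :=
  mul_nonneg (Real.cosh_pos _).le (Real.exp_pos _).le

lemma compensatedCosh_congr {p c l r : ℝ} {n : ℕ} {d e : ℕ → X} (h : ∀ j < n, d j = e j) :
    compensatedCosh p c l r n d = compensatedCosh p c l r n e := by
  rw [compensatedCosh, compensatedCosh, stoppedSum_congr h,
    Finset.sum_congr rfl fun j hj => by rw [h j (Finset.mem_range.1 hj)]]

lemma measurable_compensatedCosh [MeasurableSpace X] [BorelSpace X] [SecondCountableTopology X]
    (p c l r : ℝ) (n : ℕ) :
    Measurable fun d : ℕ → X => compensatedCosh p c l r n d := by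
  have h1 : Measurable fun d : ℕ → X => ∑ j ∈ Finset.range n, ‖d j‖ ^ p :=
    Finset.measurable_sum _ fun j _ => (measurable_pi_apply j).norm.pow_const p
  exact (Real.measurable_cosh.comp ((measurable_stoppedSum r n).norm.const_mul l)).mul
    (Real.measurable_exp.comp (h1.const_mul _).neg)

/-- Flipping the sign of `d n` changes neither the earlier stopped sum nor the compensator. Scaling
`hX` by `l` produces exactly the factor that the compensator cancels; after stopping, that factor
only helps. -/
lemma compensatedCosh_succ_add_le [NormedSpace ℝ X] {p c l : ℝ} (r : ℝ) (hl : 0 < l)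
    (hc : 0 ≤ c)
    (hX : ∀ x y : X, Real.cosh ‖x + y‖ + Real.cosh ‖x - y‖ ≤
      2 * (Real.cosh ‖x‖ * Real.exp (c * ‖y‖ ^ p))) (n : ℕ) (d : ℕ → X) :
    compensatedCosh p c l r (n + 1) d +
        compensatedCosh p c l r (n + 1) (Function.update d n (-d n)) ≤
      2 * compensatedCosh p c l r n d := by
  have hne : ∀ j < n, Function.update d n (-d n) j = d j := fun j hj =>
    Function.update_of_ne hj.ne _ _
  have hsum : ∑ j ∈ Finset.range n, ‖Function.update d n (-d n) j‖ ^ p =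
      ∑ j ∈ Finset.range n, ‖d j‖ ^ p :=
    Finset.sum_congr rfl fun j hj => by rw [hne j (Finset.mem_range.1 hj)]
  have hlp : 0 ≤ l ^ p := Real.rpow_nonneg hl.le p
  have hdp : 0 ≤ ‖d n‖ ^ p := Real.rpow_nonneg (norm_nonneg _) p
  have hmain : Real.cosh (l * ‖stoppedSum r d (n + 1)‖) +
      Real.cosh (l * ‖stoppedSum r (Function.update d n (-d n)) (n + 1)‖) ≤
      2 * (Real.cosh (l * ‖stoppedSum r d n‖) * Real.exp (c * l ^ p * ‖d n‖ ^ p)) := by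
    rw [stoppedSum, stoppedSum, stoppedSum_congr hne, Function.update_self]
    split_ifs with h
    · have := hX (l • stoppedSum r d n) (l • d n)
      rwa [← smul_add, ← smul_sub, norm_smul, norm_smul, norm_smul, norm_smul,
        Real.norm_of_nonneg hl.le, Real.mul_rpow hl.le (norm_nonneg _), ← mul_assoc c,
        sub_eq_add_neg] at this
    · have h1 : 1 ≤ Real.exp (c * l ^ p * ‖d n‖ ^ p) := Real.one_le_exp (by positivity)
      have := mul_le_mul_of_nonneg_left h1 (Real.cosh_pos (l * ‖stoppedSum r d n‖)).le
      linarith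
  simp only [compensatedCosh]
  rw [Finset.sum_range_succ, Finset.sum_range_succ, hsum, Function.update_self, norm_neg,
    ← add_mul, mul_add (c * l ^ p), neg_add, Real.exp_add]
  set E := Real.exp (-(c * l ^ p * ∑ j ∈ Finset.range n, ‖d j‖ ^ p))
  have hE : 0 < E := Real.exp_pos _
  calc _ ≤ 2 * (Real.cosh (l * ‖stoppedSum r d n‖) * Real.exp (c * l ^ p * ‖d n‖ ^ p)) *
        (E * Real.exp (-(c * l ^ p * ‖d n‖ ^ p))) := by gcongr
    _ = 2 * (Real.cosh (l * ‖stoppedSum r d n‖) * E) *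
        (Real.exp (c * l ^ p * ‖d n‖ ^ p) * Real.exp (-(c * l ^ p * ‖d n‖ ^ p))) := by ring
    _ = _ := by rw [← Real.exp_add, add_neg_cancel, Real.exp_zero, mul_one]

end StoppedSum

/-! ### Conditional symmetry and the exponential maximal inequality -/

section Symmetry

variable {Ω X : Type*} [MeasurableSpace Ω] [NormedAddCommGroup X] [MeasurableSpace X]
  [BorelSpace X] [SecondCountableTopology X]

/-- Conditional symmetry, for functionals that are merely measurable. -/
lemma IsConditionallySymmetric.lintegral_eq {f : ℕ → Ω → X} {μ : Measure Ω} [IsFiniteMeasure μ]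
    (hsymm : IsConditionallySymmetric f μ) (hf : ∀ n, Measurable (f n)) (k : ℕ)
    {H : (ℕ → X) → ℝ≥0∞} (hH : Measurable H) (hdep : DependsOn H (Set.Iic k)) :
    ∫⁻ ω, H (fun j => difference f j ω) ∂μ =
      ∫⁻ ω, H (Function.update (fun j => difference f j ω) k (-difference f k ω)) ∂μ := by
  have hd : ∀ j, Measurable (difference f j) := fun j => (hf (j + 1)).sub (hf j)
  let V : (Ω → X) → Ω → Fin (k + 1) → X := fun g ω =>
    Fin.snoc (α := fun _ => X) (fun i : Fin k => difference f i ω) (g ω)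
  have hV : ∀ g : Ω → X, Measurable g → Measurable (V g) := fun g hg =>
    measurable_pi_lambda _ fun i => by
      refine Fin.lastCases ?_ (fun i => ?_) i
      · simpa [V] using hg
      · simpa [V] using hd i
  have h1 := hV _ (hd k)
  have h2 := hV (fun ω => -difference f k ω) (hd k).neg
  -- Bounded continuous functions determine a finite measure, so symmetry is an equality of laws.
  have hmap : μ.map (V (difference f k)) = μ.map (V fun ω => -difference f k ω) := by
    refine ext_of_forall_integral_eq_of_IsFiniteMeasure fun φ => ?_
    rw [integral_map h1.aemeasurable φ.continuous.aestronglyMeasurable,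
      integral_map h2.aemeasurable φ.continuous.aestronglyMeasurable]
    exact hsymm k φ
  let F : (Fin (k + 1) → X) → ℝ≥0∞ := fun v =>
    H fun j => if h : j < k + 1 then v ⟨j, h⟩ else 0
  have hF : Measurable F := by
    refine hH.comp (measurable_pi_lambda _ fun j => ?_)
    split_ifs with h
    · exact measurable_pi_apply _
    · exact measurable_const
  have hFV : ∀ (g : Ω → X) ω,
      F (V g ω) = H (Function.update (fun j => difference f j ω) k (g ω)) := fun g ω =>
    hdep fun j hj => by
      have hj' : j < k + 1 := Nat.lt_succ_of_le hj
      rw [dif_pos hj']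
      rcases eq_or_lt_of_le (Set.mem_Iic.1 hj) with rfl | hlt
      · rw [Function.update_self]
        exact Fin.snoc_last (α := fun _ => X) _ _
      · rw [Function.update_of_ne hlt.ne]
        exact Fin.snoc_castSucc (α := fun _ => X) (g ω) (fun i : Fin k => difference f i ω)
          ⟨j, hlt⟩
  have h := congrArg (fun ν => ∫⁻ v, F v ∂ν) hmap
  simp only [lintegral_map hF h1, lintegral_map hF h2, hFV] at h
  simpa only [Function.update_eq_self] using h

/-- By symmetry, twice the integral at `n + 1` is the integral of the sum over both signs of the
last difference, which the pathwise inequality bounds. -/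
lemma lintegral_compensatedCosh_le_one [NormedSpace ℝ X] {f : ℕ → Ω → X} {μ : Measure Ω}
    [IsProbabilityMeasure μ] (hsymm : IsConditionallySymmetric f μ)
    (hf : ∀ n, Measurable (f n)) {p c l : ℝ} (r : ℝ) (hl : 0 < l) (hc : 0 ≤ c)
    (hX : ∀ x y : X, Real.cosh ‖x + y‖ + Real.cosh ‖x - y‖ ≤
      2 * (Real.cosh ‖x‖ * Real.exp (c * ‖y‖ ^ p))) (n : ℕ) :
    ∫⁻ ω, ENNReal.ofReal (compensatedCosh p c l r n fun j => difference f j ω) ∂μ ≤ 1 := by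
  have hd : Measurable fun ω j => difference f j ω :=
    measurable_pi_lambda _ fun j => (hf (j + 1)).sub (hf j)
  induction n with
  | zero => simp [compensatedCosh, stoppedSum]
  | succ n ih =>
    refine le_trans ?_ ih
    have hH := (measurable_compensatedCosh (X := X) p c l r (n + 1)).ennreal_ofReal
    have hsymm' := hsymm.lintegral_eq hf n hH fun d e hde =>
      congrArg ENNReal.ofReal (compensatedCosh_congr fun j hj => hde j (Nat.le_of_lt_succ hj))
    have hsum : 2 * ∫⁻ ω, ENNReal.ofReal
          (compensatedCosh p c l r (n + 1) fun j => difference f j ω) ∂μ ≤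
        2 * ∫⁻ ω, ENNReal.ofReal (compensatedCosh p c l r n fun j => difference f j ω) ∂μ := by
      rw [two_mul]
      nth_rw 2 [hsymm']
      have hm : Measurable fun ω => ENNReal.ofReal
          (compensatedCosh p c l r (n + 1) fun j => difference f j ω) := hH.comp hd
      rw [← lintegral_add_left hm, ← lintegral_const_mul' _ _ ENNReal.ofNat_ne_top]
      refine lintegral_mono fun ω => ?_
      dsimp only
      rw [← ENNReal.ofReal_add (compensatedCosh_nonneg ..) (compensatedCosh_nonneg ..),
        ← ENNReal.ofReal_ofNat, ← ENNReal.ofReal_mul zero_le_two]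
      exact ENNReal.ofReal_le_ofReal
        (compensatedCosh_succ_add_le r hl hc hX n fun j => difference f j ω)
    exact (ENNReal.mul_le_mul_iff_right two_ne_zero ENNReal.ofNat_ne_top).1 hsum

/-- The exponential maximal inequality with a free parameter `l`. -/
lemma measureReal_le_maximalFunction_le [NormedSpace ℝ X] {f : ℕ → Ω → X} {μ : Measure Ω}
    [IsProbabilityMeasure μ] (hsymm : IsConditionallySymmetric f μ)
    (hf : ∀ n, Measurable (f n)) {p c l b r : ℝ} (hl : 0 < l) (hc : 0 ≤ c)
    (hX : ∀ x y : X, Real.cosh ‖x + y‖ + Real.cosh ‖x - y‖ ≤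
      2 * (Real.cosh ‖x‖ * Real.exp (c * ‖y‖ ^ p)))
    (hb : ∀ᵐ ω ∂μ, ∀ n, ∑ j ∈ Finset.range n, ‖difference f j ω‖ ^ p ≤ b) (hr : 0 < r) :
    μ.real {ω | ENNReal.ofReal r ≤ maximalFunction f ω} ≤
      2 * Real.exp (-(l * r) + c * l ^ p * b) := by
  have hd : Measurable fun ω j => difference f j ω :=
    measurable_pi_lambda _ fun j => (hf (j + 1)).sub (hf j)
  have hlp : 0 ≤ l ^ p := Real.rpow_nonneg hl.le p
  have hstep : ∀ t, 0 < t → ∀ n,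
      μ {ω | t ≤ ‖stoppedSum t (fun j => difference f j ω) n‖} ≤
        ENNReal.ofReal (2 * Real.exp (-(l * t) + c * l ^ p * b)) := by
    intro t ht n
    -- The Markov threshold: `cosh u ≥ exp u / 2`, and the compensator is at least `exp (-(c l^p
    -- b))`.
    set ε := Real.exp (l * t - c * l ^ p * b) / 2 with hε
    have hε0 : 0 < ε := by positivity
    have hinv : 2 * Real.exp (-(l * t) + c * l ^ p * b) = ε⁻¹ := by
      rw [hε, inv_div, div_eq_mul_inv, ← Real.exp_neg, neg_sub, sub_eq_neg_add]
    have hmark := (mul_meas_ge_le_lintegral (μ := μ)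
      ((measurable_compensatedCosh (X := X) p c l t n).ennreal_ofReal.comp hd)
      (ENNReal.ofReal ε)).trans
      (lintegral_compensatedCosh_le_one hsymm hf t hl hc hX n)
    rw [hinv, ENNReal.ofReal_inv_of_pos hε0]
    refine le_trans ?_ (ENNReal.le_inv_iff_mul_le.2 ((mul_comm _ _).trans_le hmark))
    refine measure_mono_ae ?_
    filter_upwards [hb] with ω hω hmem
    refine ENNReal.ofReal_le_ofReal ?_
    have h1 : Real.exp (l * t) / 2 ≤
        Real.cosh (l * ‖stoppedSum t (fun j => difference f j ω) n‖) := by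
      have h2 : Real.exp (l * t) ≤
          Real.exp (l * ‖stoppedSum t (fun j => difference f j ω) n‖) := by
        gcongr
        exact hmem
      rw [Real.cosh_eq]
      have := Real.exp_pos (-(l * ‖stoppedSum t (fun j => difference f j ω) n‖))
      linarith
    calc ε = Real.exp (l * t) / 2 * Real.exp (-(c * l ^ p * b)) := by
          rw [hε, sub_eq_add_neg, Real.exp_add]
          ring
      _ ≤ _ := by
          unfold compensatedCosh
          gcongr
          exact hω n
  -- The supremum may equal `r` without being attained, so a level `t < r` is used, followed by `t ↑
  -- r`.
  have hlt : ∀ t, 0 < t → t < r → μ.real {ω | ENNReal.ofReal r ≤ maximalFunction f ω} ≤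
      2 * Real.exp (-(l * t) + c * l ^ p * b) := by
    intro t ht htr
    refine ENNReal.toReal_le_of_le_ofReal (by positivity) ?_
    have hmono : Monotone fun n => {ω | t ≤ ‖stoppedSum t (fun j => difference f j ω) n‖} :=
      fun n m hnm ω hω => by
        rw [Set.mem_ofPred_eq, stoppedSum_eq_of_le hω hnm]
        exact hω
    refine le_trans (measure_mono fun ω hω => ?_)
      (le_of_tendsto' (tendsto_measure_iUnion_atTop hmono) (hstep t ht))
    have hlt : ENNReal.ofReal t < maximalFunction f ω :=
      ((ENNReal.ofReal_lt_ofReal_iff hr).2 htr).trans_le hω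
    obtain ⟨j, hj⟩ := lt_iSup_iff.1 hlt
    refine Set.mem_iUnion.2 ⟨j + 1, le_norm_stoppedSum ?_⟩
    rw [← ofReal_norm, ENNReal.ofReal_lt_ofReal_iff_of_nonneg ht.le] at hj
    simp only [difference]
    rw [Finset.sum_range_sub fun i => f i ω]
    exact hj.le
  have hcont : Filter.Tendsto (fun t => 2 * Real.exp (-(l * t) + c * l ^ p * b))
      (nhdsWithin r (Set.Iio r)) (nhds (2 * Real.exp (-(l * r) + c * l ^ p * b))) :=
    (Continuous.tendsto (by fun_prop) r).mono_left nhdsWithin_le_nhds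
  refine ge_of_tendsto hcont ?_
  filter_upwards [Ioo_mem_nhdsLT hr] with t ht using hlt t ht.1 ht.2

end Symmetry

/-! ### The bound on the power sums and the choice of parameter -/

lemma sum_norm_difference_rpow_le {Ω X : Type*} [MeasurableSpace Ω] [NormedAddCommGroup X]
    {f : ℕ → Ω → X} {μ : Measure Ω} {p b : ℝ} (hp : 0 < p) (hb : 0 ≤ b)
    (h : eLpNorm (fun ω => pFunction p f ω ^ p) ∞ μ ≤ ENNReal.ofReal b) :
    ∀ᵐ ω ∂μ, ∀ n, ∑ j ∈ Finset.range n, ‖difference f j ω‖ ^ p ≤ b := by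
  rw [eLpNorm_exponent_top] at h
  filter_upwards [ae_le_eLpNormEssSup (f := fun ω => pFunction p f ω ^ p) (μ := μ)] with ω hω n
  have h1 := hω.trans h
  rw [enorm_eq_self, pFunction, ← ENNReal.rpow_mul, one_div_mul_cancel hp.ne',
    ENNReal.rpow_one] at h1
  rw [← ENNReal.ofReal_le_ofReal_iff hb, ENNReal.ofReal_sum_of_nonneg fun j _ => by positivity]
  refine le_trans (le_of_eq ?_) ((ENNReal.sum_le_tsum (Finset.range n)).trans h1)
  refine Finset.sum_congr rfl fun j _ => ?_
  rw [← ENNReal.ofReal_rpow_of_nonneg (norm_nonneg _) hp.le, ofReal_norm]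

/-- A choice of the parameter in the exponential maximal inequality. -/
lemma exists_pos_neg_mul_add_le {p c : ℝ} (hp1 : 1 < p) (hp2 : p ≤ 2) (hc : 0 < c) :
    ∃ K : ℝ, 1 ≤ K ∧ ∀ b r : ℝ, 0 < b → 0 < r → b ≤ r ^ p →
      ∃ l : ℝ, 0 < l ∧ -(l * r) + c * l ^ p * b ≤ -(r ^ p / (2 * K * b)) := by
  have hp : 0 < p - 1 := sub_pos.2 hp1
  -- Chosen so that `c * t ^ p` is exactly half of `t`.
  set t := (1 / (2 * c)) ^ (1 / (p - 1)) with ht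
  have ht0 : 0 < t := by positivity
  have htp : c * t ^ p = t / 2 := by
    have h1 : t ^ (p - 1) = 1 / (2 * c) := by
      rw [ht, ← Real.rpow_mul (by positivity), one_div_mul_cancel hp.ne', Real.rpow_one]
    rw [show p = (p - 1) + 1 by ring, Real.rpow_add ht0, h1, Real.rpow_one]
    field_simp
  refine ⟨max 1 t⁻¹, le_max_left _ _, fun b r hb hr hbr => ?_⟩
  have hK : 0 < max 1 t⁻¹ := lt_max_of_lt_left one_pos
  have hrp : 0 < r ^ p := by positivity
  set R := r ^ p / b with hR
  have hR1 : 1 ≤ R := (one_le_div hb).2 hbr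
  have hR0 : 0 < R := one_pos.trans_le hR1
  -- Now `l * r = t * R`, while the other term is `(t / 2) * R ^ (p - 1) ≤ (t / 2) * R` because `R ≥
  -- 1` and `p ≤ 2`.
  refine ⟨t * R / r, by positivity, ?_⟩
  have h1 : t * R / r * r = t * R := by field_simp
  have h2 : (t * R / r) ^ p * b = t ^ p * R ^ (p - 1) := by
    have hrR : r ^ p = R * b := (div_mul_cancel₀ _ hb.ne').symm
    rw [Real.div_rpow (by positivity) hr.le, Real.mul_rpow ht0.le hR0.le,
      Real.rpow_sub hR0, Real.rpow_one, hrR]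
    field_simp
  have h3 : R ^ (p - 1) ≤ R := by
    simpa using Real.rpow_le_rpow_of_exponent_le hR1 (by linarith : p - 1 ≤ 1)
  have h4 : c * (t * R / r) ^ p * b ≤ t / 2 * R := by
    rw [mul_assoc, h2, ← mul_assoc, htp]
    gcongr
  have h5 : r ^ p / (2 * max 1 t⁻¹ * b) ≤ t / 2 * R := by
    have h6 : 1 ≤ max 1 t⁻¹ * t := by
      calc (1 : ℝ) = t⁻¹ * t := (inv_mul_cancel₀ ht0.ne').symm
        _ ≤ _ := by gcongr; exact le_max_right _ _
    have h7 : r ^ p / (2 * max 1 t⁻¹ * b) = R / (2 * max 1 t⁻¹) := by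
      rw [hR]
      field_simp
    rw [h7, div_le_iff₀ (by positivity)]
    nlinarith
  rw [h1]
  linarith

end BanachMartingale

theorem mainTheorem5 {X : Type*} [NormedAddCommGroup X] [NormedSpace ℝ X] [CompleteSpace X]
    [TopologicalSpace.SeparableSpace X] (p : ℝ) (hp1 : 1 < p) (hp2 : p ≤ 2)
    (hX : BanachMartingale.IsUniformlySmooth X p) :
    ∃ K : ℝ, 0 < K ∧
      ∀ (Ω : Type*) [mΩ : MeasurableSpace Ω] (μ : Measure Ω) [IsProbabilityMeasure μ]
        (ℱ : Filtration ℕ mΩ) (f : ℕ → Ω → X),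
        Martingale f ℱ μ →
        BanachMartingale.IsConditionallySymmetric f μ →
        ∀ b : ℝ, 0 < b →
          eLpNorm (fun ω => BanachMartingale.pFunction p f ω ^ p) ∞ μ ≤ ENNReal.ofReal b →
          ∀ r : ℝ, 0 ≤ r →
            μ.real {ω | ENNReal.ofReal r ≤ BanachMartingale.maximalFunction f ω} ≤
              2 * Real.exp (-(r ^ p / (2 * K * b))) := by
  obtain ⟨s, hs0, hs⟩ := hX
  have hp : 0 < p := one_pos.trans hp1
  have hc : 0 < 2 * s + 3 := by positivity
  obtain ⟨K, hK1, hK⟩ := BanachMartingale.exists_pos_neg_mul_add_le hp1 hp2 hc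
  have hK0 : 0 < K := one_pos.trans_le hK1
  refine ⟨K, hK0, fun Ω mΩ μ _ ℱ f hf hsymm b hb hfb r hr => ?_⟩
  borelize X
  have : SecondCountableTopology X := UniformSpace.secondCountable_of_separable X
  by_cases hrb : b ≤ r ^ p
  · have hr0 : 0 < r := hr.lt_of_ne fun h => by
      rw [← h, Real.zero_rpow hp.ne'] at hrb
      exact hb.not_ge hrb
    obtain ⟨l, hl, hlK⟩ := hK b r hb hr0 hrb
    have hmeas : ∀ n, Measurable (f n) := fun n =>
      ((hf.stronglyAdapted n).mono (ℱ.le n)).measurable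
    refine (BanachMartingale.measureReal_le_maximalFunction_le hsymm hmeas hl hc.le
      (BanachMartingale.cosh_norm_add_add_cosh_norm_sub_le hp1 hp2 hs0 hs)
      (BanachMartingale.sum_norm_difference_rpow_le hp hb.le hfb) hr0).trans ?_
    gcongr
  -- For `r ^ p < b`, `K ≥ 1` keeps the exponent at least `-1/2`, and `2 exp (-1/2) ≥ 1`.
  · refine measureReal_le_one.trans ?_
    have h1 : r ^ p / (2 * K * b) ≤ 1 / 2 := by
      rw [div_le_iff₀ (by positivity)]
      nlinarith [not_le.1 hrb]
    have h2 := Real.add_one_le_exp (-(r ^ p / (2 * K * b)))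
    linarith
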